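/- Let $P_1,\dots,P_n$ be differential operators with constant real coefficients on $\mathbb R^d$, $P_j=\sum_{|\alpha|\le m_j}c_{j,\alpha}D^\alpha$, acting on the tempered distributions $\mathcal S'(\mathbb R^d)$; let $P_j^*=\sum_\alpha(-1)^{|\alpha|}c_{j,\alpha}D^\alpha$ be their adjoint operators, $\hat p_j(x)=\sum_\alpha c_{j,\alpha}(ix)^\alpha$ their symbols, $\mathbf P=(P_1,\dots,P_n)^T$, $\hat{\mathbf p}=(\hat p_1,\dots,\hat p_n)^T$ and $L=\mathbf P^{*T}\mathbf P=\sum_{j=1}^nP_j^*P_j$. Suppose that $\hat{\mathbf p}(x)\neq0$ for every $x\in\mathbb R^d$ and that $x\mapsto\|\hat{\mathbf p}(x)\|_2^{-2}$ is in $L_1(\mathbb R^d)$. Let $G:\mathbb R^d\to\mathbb R$ be continuous, integrable and even, and a Green function of $L$, i.e. $LG=\delta_0$ in $\mathcal S'(\mathbb R^d)$. Then: (1) $G$ is a positive definite function: $\sum_{j,k=1}^Nc_jc_kG(x_j-x_k)>0$ for all $N$, all pairwise distinct $x_1,\dots,x_N\in\mathbb R^d$ and all $c\in\mathbb R^N\setminus\{0\}$.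 (2) Let $\mathcal N_G(\mathbb R^d)$ be the real Hilbert space of functions $\mathbb R^d\to\mathbb R$ with reproducing kernel $K(x,y)=G(x-y)$ (it exists), and let $$H_{\mathbf P}(\mathbb R^d)=\{f\in L_2(\mathbb R^d)\text{ real-valued}: P_jf\in L_2(\mathbb R^d),\ j=1,\dots,n\},\qquad (f,g)_{H_{\mathbf P}}=\sum_{j=1}^n\int_{\mathbb R^d}P_jf(x)\,\overline{P_jg(x)}\,dx,$$ where $P_jf$ is taken in the sense of distributions. Then $\mathcal N_G(\mathbb R^d)=H_{\mathbf P}(\mathbb R^d)$ with equal inner products: the elements of $\mathcal N_G(\mathbb R^d)$ are continuous functions, passing to the class modulo equality almost everywhere is a linear bijection of $\mathcal N_G(\mathbb R^d)$ onto $H_{\mathbf P}(\mathbb R^d)$, and $(f,g)_{\mathcal N_G}=(f,g)_{H_{\mathbf P}}$ for all $f,g\in\mathcal N_G(\mathbb R^d)$. -/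

import Mathlib

open MeasureTheory
open scoped SchwartzMap LineDeriv ENNReal

noncomputable section

namespace GenSobolev

/-- The space `ℝ^d` with the Euclidean norm. -/
abbrev Rd (d : ℕ) : Type := EuclideanSpace ℝ (Fin d)

/-- A multi-index `α ∈ ℕ₀^d`. -/
abbrev MultiIndex (d : ℕ) : Type := Fin d →₀ ℕ

/-! ### Positive definite functions and reproducing kernels -/

/-- A real function `Φ` on `ℝ^d` is a positive definite function: it is continuous and even, and
for all pairwise distinct centers and all nonzero coefficient vectors the quadratic form is
(strictly) positive. -/
def IsPositiveDefinite {d : ℕ} (Φ : Rd d → ℝ) : Prop :=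
  Continuous Φ ∧ (∀ x, Φ (-x) = Φ x) ∧
    ∀ (N : ℕ) (x : Fin N → Rd d), Function.Injective x →
      ∀ c : Fin N → ℝ, c ≠ 0 → 0 < ∑ j, ∑ k, c j * c k * Φ (x j - x k)

/-- `K` is a reproducing kernel for the real Hilbert space `H` of functions `X → ℝ`:
`K(·, y) ∈ H` for all `y`, and `f(y) = (K(·, y), f)_H` for all `f ∈ H` and all `y`. -/
def IsReproducingKernel {X : Type*} (H : Type*) [NormedAddCommGroup H] [InnerProductSpace ℝ H]
    [RKHS ℝ H X ℝ] (K : X → X → ℝ) : Prop :=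
  ∀ y : X, ∃ k : H, (∀ x, k x = K x y) ∧ ∀ f : H, f y = inner ℝ k f

/-! ### Differential operators on tempered distributions -/

/-- The derivative `D^α = ∏ₖ ∂ₖ^{αₖ}` on the Schwartz space. -/
def schwartzDeriv {d : ℕ} (α : MultiIndex d) : 𝓢(Rd d, ℂ) →L[ℂ] 𝓢(Rd d, ℂ) :=
  ((List.finRange d).map fun k ↦
    (LineDeriv.lineDerivOpCLM ℂ 𝓢(Rd d, ℂ) (EuclideanSpace.single k (1 : ℝ) : Rd d)) ^ α k).prod

/-- The distributional derivative `D^α` on tempered distributions,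
`⟨D^α T, γ⟩ = (-1)^|α| ⟨T, D^α γ⟩`. -/
def distrDeriv {d : ℕ} (α : MultiIndex d) : 𝓢'(Rd d, ℂ) →L[ℂ] 𝓢'(Rd d, ℂ) :=
  (-1 : ℂ) ^ α.degree • PointwiseConvergenceCLM.precomp ℂ (schwartzDeriv α)

/-- A differential operator `P = ∑_α c_α D^α` with real constant coefficients, given by its finite
family of coefficients `α ↦ c_α`. -/
abbrev DiffOp (d : ℕ) : Type := MultiIndex d →₀ ℝ

/-- The action `P = ∑_α c_α D^α` on tempered distributions. -/
def DiffOp.op {d : ℕ} (P : DiffOp d) : 𝓢'(Rd d, ℂ) →L[ℂ] 𝓢'(Rd d, ℂ) :=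
  P.sum fun α c ↦ (c : ℂ) • distrDeriv α

/-- The distributional adjoint operator `P* = ∑_α (-1)^|α| c_α D^α` on tempered distributions. -/
def DiffOp.adjointOp {d : ℕ} (P : DiffOp d) : 𝓢'(Rd d, ℂ) →L[ℂ] 𝓢'(Rd d, ℂ) :=
  P.sum fun α c ↦ ((-1 : ℂ) ^ α.degree * (c : ℂ)) • distrDeriv α

/-- The symbol (distributional Fourier transform) `p̂(x) = ∑_α c_α (i x)^α` of `P`. -/
def DiffOp.symbol {d : ℕ} (P : DiffOp d) (x : Rd d) : ℂ :=
  P.sum fun α c ↦ (c : ℂ) * ∏ k, (Complex.I * (x k : ℂ)) ^ α k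

/-- The symbol vector `p̂ = (p̂₁, …, p̂ₙ)` of `P = (P₁, …, Pₙ)`. -/
def symbolVec {d n : ℕ} (P : Fin n → DiffOp d) (x : Rd d) : EuclideanSpace ℂ (Fin n) :=
  WithLp.toLp 2 fun j ↦ (P j).symbol x

/-- The operator `L = P*ᵀ P = ∑ⱼ Pⱼ* Pⱼ`. -/
def adjointCompSelf {d n : ℕ} (P : Fin n → DiffOp d) : 𝓢'(Rd d, ℂ) →L[ℂ] 𝓢'(Rd d, ℂ) :=
  ∑ j, (P j).adjointOp ∘L (P j).op

/-- The tempered distribution `γ ↦ ∫ f γ` of a real integrable function `f`. -/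
def integrableDistr {d : ℕ} {f : Rd d → ℝ} (hf : Integrable f) : 𝓢'(Rd d, ℂ) :=
  Lp.toTemperedDistribution (hf.ofReal (𝕜 := ℂ)).toL1

/-- `G` is a (full-space) Green function with respect to `L`: `L G = δ₀`. -/
def IsGreenFunction {d : ℕ} (L : 𝓢'(Rd d, ℂ) →L[ℂ] 𝓢'(Rd d, ℂ)) (G : 𝓢'(Rd d, ℂ)) : Prop :=
  L G = TemperedDistribution.delta 0

/-! ### The generalized Sobolev space -/

/-- The tempered distribution `γ ↦ ∫ f γ` of a real square-integrable function `f`. -/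
def l2Distr {d : ℕ} (f : Lp ℝ 2 (volume : Measure (Rd d))) : 𝓢'(Rd d, ℂ) :=
  Lp.toTemperedDistribution (Complex.ofRealCLM.compLp f)

theorem l2Distr_add {d : ℕ} (f g : Lp ℝ 2 (volume : Measure (Rd d))) :
    l2Distr (f + g) = l2Distr f + l2Distr g := by
  have h := map_add (Lp.toTemperedDistributionCLM ℂ (volume : Measure (Rd d)) 2)
    (Complex.ofRealCLM.compLp f) (Complex.ofRealCLM.compLp g)
  have h2 : Complex.ofRealCLM.compLp (f + g) =
      Complex.ofRealCLM.compLp f + Complex.ofRealCLM.compLp g :=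
    map_add (Complex.ofRealCLM.compLpL 2 (volume : Measure (Rd d))) f g
  rw [← h2] at h
  exact h

theorem l2Distr_smul {d : ℕ} (c : ℝ) (f : Lp ℝ 2 (volume : Measure (Rd d))) :
    l2Distr (c • f) = (c : ℂ) • l2Distr f := by
  have h := map_smul (Lp.toTemperedDistributionCLM ℂ (volume : Measure (Rd d)) 2) (c : ℂ)
    (Complex.ofRealCLM.compLp f)
  have h2 : Complex.ofRealCLM.compLp (c • f) = (c : ℂ) • Complex.ofRealCLM.compLp f :=
    (map_smul (Complex.ofRealCLM.compLpL 2 (volume : Measure (Rd d))) c f).trans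
      (Complex.coe_smul c _).symm
  rw [← h2] at h
  exact h

/-- The generalized Sobolev space `H_P`: the real square-integrable functions `f` on `ℝ^d` such
that each distribution `Pⱼ f` is given by a square-integrable function. -/
def genSobolev {d n : ℕ} (P : Fin n → DiffOp d) :
    Submodule ℝ (Lp ℝ 2 (volume : Measure (Rd d))) where
  carrier := {f | ∀ j, ∃ g : Lp ℂ 2 (volume : Measure (Rd d)),
    Lp.toTemperedDistribution g = (P j).op (l2Distr f)}
  zero_mem' := fun j ↦ by
    have h0 : l2Distr (0 : Lp ℝ 2 (volume : Measure (Rd d))) = 0 := by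
      have h := l2Distr_add (0 : Lp ℝ 2 (volume : Measure (Rd d))) 0
      rw [add_zero] at h
      exact left_eq_add.mp h
    refine ⟨0, ?_⟩
    rw [h0, map_zero]
    exact map_zero (Lp.toTemperedDistributionCLM ℂ (volume : Measure (Rd d)) 2)
  add_mem' := fun {f₁ f₂} h₁ h₂ j ↦ by
    obtain ⟨g₁, hg₁⟩ := h₁ j
    obtain ⟨g₂, hg₂⟩ := h₂ j
    refine ⟨g₁ + g₂, ?_⟩
    rw [l2Distr_add, map_add, ← hg₁, ← hg₂]
    exact map_add (Lp.toTemperedDistributionCLM ℂ (volume : Measure (Rd d)) 2) g₁ g₂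
  smul_mem' := fun c f h j ↦ by
    obtain ⟨g, hg⟩ := h j
    refine ⟨(c : ℂ) • g, ?_⟩
    rw [l2Distr_smul, map_smul, ← hg]
    exact map_smul (Lp.toTemperedDistributionCLM ℂ (volume : Measure (Rd d)) 2) (c : ℂ) g

/-- The square-integrable function `Pⱼ f`, for `f` in the generalized Sobolev space (it is unique,
as a square-integrable function is determined by its distribution). -/
def weakImage {d n : ℕ} (P : Fin n → DiffOp d) (j : Fin n) (f : genSobolev P) :
    Lp ℂ 2 (volume : Measure (Rd d)) :=
  (f.2 j).choose

/-- `(f, g)_{H_P} = ∑ⱼ ∫ (Pⱼ f) (x) * conj ((Pⱼ g) (x)) dx`. -/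
def sobolevInner {d n : ℕ} (P : Fin n → DiffOp d) (f g : genSobolev P) : ℂ :=
  ∑ j, ∫ x, weakImage P j f x * starRingEnd ℂ (weakImage P j g x)

end GenSobolev

end

/-! Everything happens on the Fourier side, with the normalisation `e^{-2πi⟨x,ξ⟩}`. There `P_j` is
multiplication by `p̂_j(2πξ)`, its adjoint is multiplication by the conjugate, and `L` is
multiplication by `‖p̂(2πξ)‖²`. Hence `LG = δ₀` forces the transform of `G` to be `W²`, where `W(ξ)
= ‖p̂(2πξ)‖⁻¹` is continuous, positive, bounded and square-integrable (`exists_spectralFactor`).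

Put `k_x(ξ) = e^{-2πi⟨ξ,x⟩} W(ξ)` in `L²`. Fourier inversion gives `G(x - y) = ⟪k_x, k_y⟫`, so the
quadratic form of `G` is a squared norm. It is positive because the `k_x` are linearly independent.

A vector `u` in `L²` represents the function `x ↦ ⟪k_x, u⟫`, the inverse transform of `W u`. The `u`
whose function is real form a real Hilbert space with kernel `G(x - y)`. If `f` is the function of
`u`, then `P_j f` has transform `p̂_j(2πξ) W u`. Since `∑ |p̂_j(2πξ)|² W² = 1`, the Sobolev inner
product is the `L²` inner product of the representing vectors (`sobolevInner_eq`). Conversely, for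
`f` in `H_P` the vector `W⁻¹ 𝓕 f` is square-integrable and represents `f`
(`exists_ae_eq_of_mem_genSobolev`). A Hilbert function space is determined by its kernel
(`exists_linearIsometryEquiv`), which carries the result from this model to every native space. -/

noncomputable section

namespace GenSobolev

open FourierTransform Real

variable {d n : ℕ}

/-! ### Differential operators as Fourier multipliers -/

/-- `A` is conjugated by the Fourier transform to the multiplication by `g`. -/
def IsFourierConj (A : 𝓢(Rd d, ℂ) →L[ℂ] 𝓢(Rd d, ℂ)) (g : Rd d → ℂ) : Prop :=
  g.HasTemperateGrowth ∧ ∀ γ : 𝓢(Rd d, ℂ), A (𝓕 γ) = 𝓕 (SchwartzMap.smulLeftCLM ℂ g γ)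

theorem IsFourierConj.one : IsFourierConj (d := d) 1 1 := by
  refine ⟨.const 1, fun γ ↦ ?_⟩
  have h : SchwartzMap.smulLeftCLM ℂ (1 : Rd d → ℂ) γ = γ := by
    ext x
    rw [SchwartzMap.smulLeftCLM_apply_apply (g := 1) (.const 1)]
    simp
  rw [h]
  rfl

theorem IsFourierConj.mul {A B : 𝓢(Rd d, ℂ) →L[ℂ] 𝓢(Rd d, ℂ)} {g h : Rd d → ℂ}
    (hA : IsFourierConj A g) (hB : IsFourierConj B h) : IsFourierConj (A * B) (g * h) := by
  refine ⟨hA.1.mul hB.1, fun γ ↦ ?_⟩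
  rw [← SchwartzMap.smulLeftCLM_smulLeftCLM_apply hA.1 hB.1]
  change A (B (𝓕 γ)) = _
  rw [hB.2, hA.2]

theorem IsFourierConj.pow {A : 𝓢(Rd d, ℂ) →L[ℂ] 𝓢(Rd d, ℂ)} {g : Rd d → ℂ}
    (hA : IsFourierConj A g) (m : ℕ) : IsFourierConj (A ^ m) (g ^ m) := by
  induction m with
  | zero => simpa using IsFourierConj.one
  | succ m ih => simpa only [pow_succ] using ih.mul hA

theorem IsFourierConj.list_prod {ι : Type*} (l : List ι)
    {A : ι → 𝓢(Rd d, ℂ) →L[ℂ] 𝓢(Rd d, ℂ)} {g : ι → Rd d → ℂ}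
    (h : ∀ i, IsFourierConj (A i) (g i)) :
    IsFourierConj (l.map A).prod (l.map g).prod := by
  induction l with
  | nil => simpa using IsFourierConj.one
  | cons i l ih => simpa using (h i).mul ih

theorem isFourierConj_lineDeriv (m : Rd d) :
    IsFourierConj (LineDeriv.lineDerivOpCLM ℂ 𝓢(Rd d, ℂ) m)
      (fun x ↦ -(2 * π * Complex.I) * ((inner ℝ x m : ℝ) : ℂ)) := by
  have h0 : (fun x : Rd d ↦ inner ℝ x m).HasTemperateGrowth := by fun_prop
  have hg : (fun x : Rd d ↦ -(2 * π * Complex.I) * ((inner ℝ x m : ℝ) : ℂ)).HasTemperateGrowth := by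
    fun_prop
  refine ⟨hg, fun γ ↦ ?_⟩
  rw [LineDeriv.lineDerivOpCLM_apply, SchwartzMap.lineDerivOp_fourier_eq]
  congr 1
  ext x
  rw [SchwartzMap.smulLeftCLM_apply_apply hg, _root_.smul_apply,
    SchwartzMap.smulLeftCLM_apply_apply h0]
  simp [mul_assoc]

/-- The Fourier multiplier of `D^α`. -/
def derivMultiplier (α : MultiIndex d) (ξ : Rd d) : ℂ :=
  ∏ k, (Complex.I * (((2 * π) • ξ) k : ℂ)) ^ α k

theorem hasTemperateGrowth_derivMultiplier (α : MultiIndex d) :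
    (derivMultiplier α).HasTemperateGrowth := by
  have h : derivMultiplier α =
      ((List.finRange d).map fun k ↦ (fun ξ : Rd d ↦
        Complex.I * ((2 * π * inner ℝ ξ (EuclideanSpace.single k (1 : ℝ)) : ℝ) : ℂ)) ^ α k).prod := by
    ext ξ
    rw [← List.ofFn_eq_map, List.prod_ofFn]
    simp [derivMultiplier, EuclideanSpace.inner_single_right]
  rw [h]
  generalize List.finRange d = l
  induction l with
  | nil => exact .const 1
  | cons k l ih =>
    rw [List.map_cons, List.prod_cons]
    refine .mul (.pow ?_ _) ih
    fun_prop

/-- On test functions the multiplier is `(-2πiξ)^α`; the sign `(-1)^|α|` of the distributional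
derivative turns it into `(2πiξ)^α`. -/
theorem fourier_distrDeriv (α : MultiIndex d) (T : 𝓢'(Rd d, ℂ)) :
    𝓕 (distrDeriv α T) = TemperedDistribution.smulLeftCLM ℂ (derivMultiplier α) (𝓕 T) := by
  have key := IsFourierConj.list_prod (List.finRange d) fun k ↦
    (isFourierConj_lineDeriv (EuclideanSpace.single k (1 : ℝ) : Rd d)).pow (α k)
  ext γ
  have h : distrDeriv α T (𝓕 γ) = (-1 : ℂ) ^ α.degree * T (schwartzDeriv α (𝓕 γ)) := rfl
  rw [TemperedDistribution.fourier_apply, h, schwartzDeriv, key.2 γ,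
    TemperedDistribution.smulLeftCLM_apply_apply, TemperedDistribution.fourier_apply,
    ← smul_eq_mul, ← map_smul, ← FourierTransform.fourier_smul]
  congr 2
  ext ξ
  rw [_root_.smul_apply, SchwartzMap.smulLeftCLM_apply_apply key.1,
    SchwartzMap.smulLeftCLM_apply_apply (hasTemperateGrowth_derivMultiplier α), ← smul_assoc]
  congr 1
  rw [← List.ofFn_eq_map, List.prod_ofFn, smul_eq_mul, derivMultiplier, Finset.prod_apply,
    Finsupp.degree_eq_sum, ← Finset.prod_pow_eq_pow_sum, ← Finset.prod_mul_distrib]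
  refine Finset.prod_congr rfl fun k _ ↦ ?_
  rw [Pi.pow_apply, ← mul_pow]
  simp only [EuclideanSpace.inner_single_right, PiLp.smul_apply]
  congr 1
  simp
  ring

/-- The Fourier multiplier `ξ ↦ p̂(2πξ)` of `P`. -/
def DiffOp.multiplier (P : DiffOp d) (ξ : Rd d) : ℂ := P.symbol ((2 * π) • ξ)

theorem DiffOp.multiplier_eq (P : DiffOp d) :
    P.multiplier = fun ξ ↦ ∑ α ∈ P.support, (P α : ℂ) * derivMultiplier α ξ := rfl

theorem DiffOp.hasTemperateGrowth_multiplier (P : DiffOp d) : P.multiplier.HasTemperateGrowth := by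
  rw [P.multiplier_eq]
  exact .sum fun α _ ↦ .mul (.const _) (hasTemperateGrowth_derivMultiplier α)

theorem DiffOp.hasTemperateGrowth_conj_multiplier (P : DiffOp d) :
    (fun ξ ↦ starRingEnd ℂ (P.multiplier ξ)).HasTemperateGrowth :=
  (Complex.conjCLE.toContinuousLinearMap.hasTemperateGrowth).comp P.hasTemperateGrowth_multiplier

theorem DiffOp.continuous_multiplier (P : DiffOp d) : Continuous P.multiplier :=
  P.hasTemperateGrowth_multiplier.1.continuous

theorem fourier_sum_distrDeriv (s : Finset (MultiIndex d)) (c : MultiIndex d → ℂ)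
    (T : 𝓢'(Rd d, ℂ)) :
    𝓕 ((∑ α ∈ s, c α • distrDeriv α) T) =
      TemperedDistribution.smulLeftCLM ℂ (fun ξ ↦ ∑ α ∈ s, c α * derivMultiplier α ξ) (𝓕 T) := by
  have h (α : MultiIndex d) : (fun ξ ↦ c α * derivMultiplier α ξ).HasTemperateGrowth :=
    .mul (.const _) (hasTemperateGrowth_derivMultiplier α)
  rw [TemperedDistribution.smulLeftCLM_sum fun α _ ↦ h α]
  simp only [_root_.sum_apply, _root_.smul_apply, FourierTransform.fourier_sum,
    FourierTransform.fourier_smul, fourier_distrDeriv]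
  refine Finset.sum_congr rfl fun α _ ↦ ?_
  exact (congrArg (· (𝓕 T)) (TemperedDistribution.smulLeftCLM_smul (F := ℂ)
    (hasTemperateGrowth_derivMultiplier α) (c α))).symm

theorem DiffOp.fourier_op (P : DiffOp d) (T : 𝓢'(Rd d, ℂ)) :
    𝓕 (P.op T) = TemperedDistribution.smulLeftCLM ℂ P.multiplier (𝓕 T) :=
  fourier_sum_distrDeriv _ _ T

/-- Each of the `|α|` factors is purely imaginary. With real coefficients, this is why the adjoint
operator has the conjugate multiplier. -/
theorem conj_derivMultiplier (α : MultiIndex d) (ξ : Rd d) :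
    starRingEnd ℂ (derivMultiplier α ξ) = (-1) ^ α.degree * derivMultiplier α ξ := by
  rw [derivMultiplier, Finsupp.degree_eq_sum, ← Finset.prod_pow_eq_pow_sum,
    ← Finset.prod_mul_distrib, map_prod]
  refine Finset.prod_congr rfl fun k _ ↦ ?_
  rw [← mul_pow, map_pow]
  simp [Complex.conj_ofNat]

theorem DiffOp.fourier_adjointOp (P : DiffOp d) (T : 𝓢'(Rd d, ℂ)) :
    𝓕 (P.adjointOp T) =
      TemperedDistribution.smulLeftCLM ℂ (fun ξ ↦ starRingEnd ℂ (P.multiplier ξ)) (𝓕 T) := by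
  have h : (fun ξ ↦ starRingEnd ℂ (P.multiplier ξ)) = fun ξ ↦
      ∑ α ∈ P.support, ((-1 : ℂ) ^ α.degree * (P α : ℂ)) * derivMultiplier α ξ := by
    ext ξ
    simp only [P.multiplier_eq, map_sum, map_mul, conj_derivMultiplier, Complex.conj_ofReal]
    exact Finset.sum_congr rfl fun α _ ↦ by ring
  rw [h]
  exact fourier_sum_distrDeriv _ _ T

theorem fourier_adjointCompSelf_apply (P : Fin n → DiffOp d) (T : 𝓢'(Rd d, ℂ)) (γ : 𝓢(Rd d, ℂ)) :
    𝓕 (adjointCompSelf P T) γ = 𝓕 T (SchwartzMap.smulLeftCLM ℂ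
      (fun ξ ↦ ∑ j, starRingEnd ℂ ((P j).multiplier ξ) * (P j).multiplier ξ) γ) := by
  have h (j : Fin n) : (fun ξ ↦
      starRingEnd ℂ ((P j).multiplier ξ) * (P j).multiplier ξ).HasTemperateGrowth :=
    (P j).hasTemperateGrowth_conj_multiplier.mul (P j).hasTemperateGrowth_multiplier
  rw [SchwartzMap.smulLeftCLM_sum fun j _ ↦ h j]
  simp only [adjointCompSelf, _root_.sum_apply, FourierTransform.fourier_sum, map_sum,
    ContinuousLinearMap.comp_apply, DiffOp.fourier_adjointOp, DiffOp.fourier_op]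
  refine Finset.sum_congr rfl fun j _ ↦ ?_
  rw [TemperedDistribution.smulLeftCLM_apply_apply, TemperedDistribution.smulLeftCLM_apply_apply,
    SchwartzMap.smulLeftCLM_smulLeftCLM_apply (P j).hasTemperateGrowth_multiplier
      (P j).hasTemperateGrowth_conj_multiplier, mul_comm]
  rfl

theorem sum_conj_mul_multiplier (P : Fin n → DiffOp d) (ξ : Rd d) :
    ∑ j, starRingEnd ℂ ((P j).multiplier ξ) * (P j).multiplier ξ =
      ((‖symbolVec P ((2 * π) • ξ)‖ ^ 2 : ℝ) : ℂ) := by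
  rw [EuclideanSpace.norm_sq_eq, Complex.ofReal_sum]
  refine Finset.sum_congr rfl fun j _ ↦ ?_
  rw [mul_comm, Complex.mul_conj, Complex.normSq_eq_norm_sq]
  rfl

/-! ### Fourier transforms of integrable and square-integrable functions -/

theorem ae_eq_of_integral_schwartz_mul_eq {f g : Rd d → ℂ} (hf : LocallyIntegrable f)
    (hg : LocallyIntegrable g)
    (h : ∀ γ : 𝓢(Rd d, ℂ), ∫ x, γ x * f x = ∫ x, γ x * g x) : f =ᵐ[volume] g := by
  refine ae_eq_of_integral_contDiff_smul_eq hf hg fun φ hφ hφc ↦ ?_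
  have h₁ : HasCompactSupport (Complex.ofRealCLM ∘ φ) := hφc.comp_left rfl
  have h₂ : ContDiff ℝ ((⊤ : ℕ∞) : WithTop ℕ∞) (Complex.ofRealCLM ∘ φ) :=
    Complex.ofRealCLM.contDiff.comp hφ
  simpa [Complex.real_smul] using h (h₁.toSchwartzMap h₂)

theorem integral_fourier_mul_eq_of_integrable {f g : Rd d → ℂ} (hf : Integrable f)
    (hg : Integrable g) : ∫ ξ, 𝓕 f ξ * g ξ = ∫ x, f x * 𝓕 g x := by
  have h := VectorFourier.integral_fourierIntegral_smul_eq_flip (L := innerₗ (Rd d))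
    continuous_fourierChar continuous_inner hf hg
  rw [flip_innerₗ] at h
  exact h

theorem integral_fourierInv_mul_eq_of_integrable {f g : Rd d → ℂ} (hf : Integrable f)
    (hg : Integrable g) : ∫ ξ, 𝓕⁻ f ξ * g ξ = ∫ x, f x * 𝓕⁻ g x := by
  rw [fourierInv_eq_fourier_comp_neg g, ← integral_fourier_mul_eq_of_integrable hf hg.comp_neg,
    ← integral_neg_eq_self]
  simp [fourierInv_eq_fourier_neg]

theorem continuous_fourier_of_integrable {f : Rd d → ℂ} (hf : Integrable f) :
    Continuous (𝓕 f) :=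
  VectorFourier.fourierIntegral_continuous (L := innerₗ (Rd d)) continuous_fourierChar
    continuous_inner hf

theorem continuous_fourierInv_of_integrable {f : Rd d → ℂ} (hf : Integrable f) :
    Continuous (𝓕⁻ f) := by
  rw [fourierInv_eq_fourier_comp_neg]
  exact continuous_fourier_of_integrable hf.comp_neg

/-- The `L²` transform and the integral formula have the same pairings with Schwartz functions. This
links Plancherel to pointwise evaluation. -/
theorem fourierInv_toLp_ae_eq {h : Rd d → ℂ} (h₁ : Integrable h) (h₂ : MemLp h 2) :
    (𝓕⁻ h₂.toLp : Lp ℂ 2 (volume : Measure (Rd d))) =ᵐ[volume] 𝓕⁻ h := by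
  refine ae_eq_of_integral_schwartz_mul_eq ((Lp.memLp _).locallyIntegrable (by norm_num))
    (continuous_fourierInv_of_integrable h₁).locallyIntegrable fun γ ↦ ?_
  have h3 := congrArg (· γ) (Lp.fourierInv_toTemperedDistribution_eq h₂.toLp)
  simp only [TemperedDistribution.fourierInv_apply, Lp.toTemperedDistribution_apply,
    smul_eq_mul] at h3
  rw [← h3, ← integral_fourierInv_mul_eq_of_integrable γ.integrable h₁,
    ← SchwartzMap.fourierInv_coe]
  refine integral_congr_ae ?_
  filter_upwards [h₂.coeFn_toLp] with x hx
  rw [hx]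

/-- The Fourier transform is injective on tempered distributions, and on the Fourier side both
distributions are locally integrable functions. -/
theorem DiffOp.toTemperedDistribution_eq_op_iff (P : DiffOp d)
    (f g : Lp ℂ 2 (volume : Measure (Rd d))) :
    Lp.toTemperedDistribution g = P.op (Lp.toTemperedDistribution f) ↔
      (𝓕 g : Lp ℂ 2 (volume : Measure (Rd d))) =ᵐ[volume]
        fun ξ ↦ P.multiplier ξ * (𝓕 f : Lp ℂ 2 (volume : Measure (Rd d))) ξ := by
  have h1 : Lp.toTemperedDistribution g = P.op (Lp.toTemperedDistribution f) ↔
      Lp.toTemperedDistribution (𝓕 g) = TemperedDistribution.smulLeftCLM ℂ P.multiplier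
        (Lp.toTemperedDistribution (𝓕 f)) := by
    rw [← Lp.fourier_toTemperedDistribution_eq, ← Lp.fourier_toTemperedDistribution_eq,
      ← P.fourier_op]
    refine ⟨congrArg _, fun h ↦ ?_⟩
    exact (FourierTransform.fourierEquiv ℂ 𝓢'(Rd d, ℂ)).injective h
  have h2 (γ : 𝓢(Rd d, ℂ)) : TemperedDistribution.smulLeftCLM ℂ P.multiplier
      (Lp.toTemperedDistribution (𝓕 f)) γ =
        ∫ ξ, γ ξ * (P.multiplier ξ * (𝓕 f : Lp ℂ 2 (volume : Measure (Rd d))) ξ) := by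
    rw [TemperedDistribution.smulLeftCLM_apply_apply, Lp.toTemperedDistribution_apply]
    refine integral_congr_ae (.of_forall fun ξ ↦ ?_)
    simp only [SchwartzMap.smulLeftCLM_apply_apply P.hasTemperateGrowth_multiplier, smul_eq_mul]
    ring
  rw [h1]
  constructor
  · intro h
    refine ae_eq_of_integral_schwartz_mul_eq ((Lp.memLp _).locallyIntegrable (by norm_num))
      (((Lp.memLp _).locallyIntegrable (by norm_num)).continuous_mul P.continuous_multiplier)
      fun γ ↦ ?_
    rw [← h2, ← h, Lp.toTemperedDistribution_apply]
    simp only [smul_eq_mul]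
  · intro h
    ext γ
    rw [h2, Lp.toTemperedDistribution_apply]
    refine integral_congr_ae ?_
    filter_upwards [h] with ξ hξ
    rw [hξ, smul_eq_mul]

theorem fourier_integrableDistr_apply {f : Rd d → ℝ} (hf : Integrable f) (γ : 𝓢(Rd d, ℂ)) :
    𝓕 (integrableDistr hf) γ = ∫ ξ, γ ξ * 𝓕 (fun x ↦ (f x : ℂ)) ξ := by
  have h : Integrable fun x ↦ (f x : ℂ) := hf.ofReal
  rw [TemperedDistribution.fourier_apply, integrableDistr, Lp.toTemperedDistribution_apply,
    ← integral_fourier_mul_eq_of_integrable γ.integrable h, ← SchwartzMap.fourier_coe]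
  refine integral_congr_ae ?_
  filter_upwards [(hf.ofReal (𝕜 := ℂ)).coeFn_toL1] with x hx
  rw [hx]
  rfl

/-- The Fourier transform of a Green function of `L` is the reciprocal of the symbol of `L`. -/
theorem IsGreenFunction.mul_fourier_eq_one {P : Fin n → DiffOp d} {G : Rd d → ℝ}
    {hG : Integrable G} (h : IsGreenFunction (adjointCompSelf P) (integrableDistr hG)) (ξ : Rd d) :
    ((‖symbolVec P ((2 * π) • ξ)‖ ^ 2 : ℝ) : ℂ) * 𝓕 (fun x ↦ (G x : ℂ)) ξ = 1 := by
  have hm : (fun ξ ↦ ∑ j, starRingEnd ℂ ((P j).multiplier ξ) *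
      (P j).multiplier ξ).HasTemperateGrowth :=
    .sum fun j _ ↦ (P j).hasTemperateGrowth_conj_multiplier.mul
      (P j).hasTemperateGrowth_multiplier
  have hc : Continuous fun ξ ↦ (∑ j, starRingEnd ℂ ((P j).multiplier ξ) *
      (P j).multiplier ξ) * 𝓕 (fun x ↦ (G x : ℂ)) ξ :=
    hm.1.continuous.mul (continuous_fourier_of_integrable hG.ofReal)
  have key : (fun ξ ↦ (∑ j, starRingEnd ℂ ((P j).multiplier ξ) *
      (P j).multiplier ξ) * 𝓕 (fun x ↦ (G x : ℂ)) ξ) =ᵐ[volume] fun _ ↦ 1 := by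
    refine ae_eq_of_integral_schwartz_mul_eq hc.locallyIntegrable
      continuous_const.locallyIntegrable fun γ ↦ ?_
    have h1 := fourier_adjointCompSelf_apply P (integrableDistr hG) γ
    rw [h, TemperedDistribution.fourier_delta_zero, Measure.toTemperedDistribution_apply volume,
      fourier_integrableDistr_apply] at h1
    simp only [mul_one]
    rw [h1]
    refine integral_congr_ae (.of_forall fun ξ ↦ ?_)
    simp only [SchwartzMap.smulLeftCLM_apply_apply hm, smul_eq_mul]
    ring
  rw [← sum_conj_mul_multiplier]
  -- Both sides are continuous, so equality almost everywhere is equality at every point.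
  exact congrFun ((hc.ae_eq_iff_eq volume continuous_const).1 key) ξ

/-! ### The spectral model of the native space -/

/-- A bounded positive continuous square-integrable function whose square is the Fourier transform
of `G`. -/
structure SpectralFactor (G : Rd d → ℝ) where
  /-- The underlying function. -/
  toFun : Rd d → ℝ
  continuous : Continuous toFun
  pos : ∀ ξ, 0 < toFun ξ
  memLp : MemLp (fun ξ ↦ (toFun ξ : ℂ)) 2
  exists_le : ∃ C, ∀ ξ, toFun ξ ≤ C
  fourierInv_sq : ∀ x, 𝓕⁻ (fun ξ ↦ (toFun ξ : ℂ) ^ 2) x = G x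

namespace SpectralFactor

variable {G : Rd d → ℝ} (W : SpectralFactor G)

theorem memLp_char_mul (x : Rd d) :
    MemLp (fun ξ ↦ (𝐞 (-inner ℝ ξ x) : ℂ) * (W.toFun ξ : ℂ)) 2 := by
  refine W.memLp.of_le_mul (c := 1) ?_ (.of_forall fun ξ ↦ by rw [norm_mul, Circle.norm_coe])
  have := W.continuous
  have h : Continuous fun ξ : Rd d ↦ (𝐞 (-inner ℝ ξ x) : ℂ) :=
    continuous_subtype_val.comp (continuous_fourierChar.comp (by fun_prop))
  exact (h.mul (by fun_prop)).aestronglyMeasurable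

/-- The square-integrable function representing the evaluation at `x`. -/
def kernelVec (x : Rd d) : Lp ℂ 2 (volume : Measure (Rd d)) := (W.memLp_char_mul x).toLp

theorem coeFn_kernelVec (x : Rd d) :
    W.kernelVec x =ᵐ[volume] fun ξ ↦ (𝐞 (-inner ℝ ξ x) : ℂ) * (W.toFun ξ : ℂ) :=
  (W.memLp_char_mul x).coeFn_toLp

/-- The spectrum of the function that `u` represents. -/
def spectrum (u : Lp ℂ 2 (volume : Measure (Rd d))) (ξ : Rd d) : ℂ := W.toFun ξ * u ξ

theorem integrable_spectrum (u : Lp ℂ 2 (volume : Measure (Rd d))) : Integrable (W.spectrum u) :=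
  W.memLp.integrable_mul (Lp.memLp u)

theorem memLp_spectrum (u : Lp ℂ 2 (volume : Measure (Rd d))) : MemLp (W.spectrum u) 2 := by
  obtain ⟨C, hC⟩ := W.exists_le
  refine (Lp.memLp u).of_le_mul (c := C) (W.integrable_spectrum u).aestronglyMeasurable
    (.of_forall fun ξ ↦ ?_)
  rw [spectrum, norm_mul, Complex.norm_real, Real.norm_of_nonneg (W.pos ξ).le]
  gcongr
  exact hC ξ

theorem inner_kernelVec (x : Rd d) (u : Lp ℂ 2 (volume : Measure (Rd d))) :
    inner ℂ (W.kernelVec x) u = 𝓕⁻ (W.spectrum u) x := by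
  rw [L2.inner_def, fourierInv_eq]
  refine integral_congr_ae ?_
  filter_upwards [W.coeFn_kernelVec x] with ξ hξ
  rw [hξ, RCLike.inner_apply, map_mul, ← Circle.coe_inv_eq_conj, ← AddChar.map_neg_eq_inv, neg_neg,
    Circle.smul_def, spectrum, smul_eq_mul, Complex.conj_ofReal]
  ring

theorem continuous_inner_kernelVec (u : Lp ℂ 2 (volume : Measure (Rd d))) :
    Continuous fun x ↦ inner ℂ (W.kernelVec x) u := by
  simp_rw [W.inner_kernelVec]
  exact continuous_fourierInv_of_integrable (W.integrable_spectrum u)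

theorem fourierInv_spectrum_ae_eq (u : Lp ℂ 2 (volume : Measure (Rd d))) :
    (𝓕⁻ (W.memLp_spectrum u).toLp : Lp ℂ 2 (volume : Measure (Rd d))) =ᵐ[volume]
      fun x ↦ inner ℂ (W.kernelVec x) u := by
  simp_rw [W.inner_kernelVec]
  exact fourierInv_toLp_ae_eq (W.integrable_spectrum u) (W.memLp_spectrum u)

theorem inner_kernelVec_kernelVec (x y : Rd d) :
    inner ℂ (W.kernelVec x) (W.kernelVec y) = G (x - y) := by
  rw [inner_kernelVec, ← W.fourierInv_sq, fourierInv_eq, fourierInv_eq]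
  refine integral_congr_ae ?_
  filter_upwards [W.coeFn_kernelVec y] with ξ hξ
  rw [spectrum, hξ, Circle.smul_def, Circle.smul_def, inner_sub_right, sub_eq_add_neg,
    AddChar.map_add_eq_mul, Circle.coe_mul, smul_eq_mul, smul_eq_mul]
  ring

/-- By Plancherel `W u` vanishes almost everywhere, and `W` has no zeros. -/
theorem eq_zero_of_inner_kernelVec_eq_zero {u : Lp ℂ 2 (volume : Measure (Rd d))}
    (h : ∀ x, inner ℂ (W.kernelVec x) u = 0) : u = 0 := by
  have h1 := W.fourierInv_spectrum_ae_eq u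
  simp_rw [h] at h1
  have h2 : (𝓕⁻ (W.memLp_spectrum u).toLp : Lp ℂ 2 (volume : Measure (Rd d))) = 0 :=
    (Lp.eq_zero_iff_ae_eq_zero).2 h1
  have h3 : (W.memLp_spectrum u).toLp = 0 :=
    (Lp.fourierTransformₗᵢ (Rd d) ℂ).symm.map_eq_zero_iff.1 h2
  rw [Lp.eq_zero_iff_ae_eq_zero] at h3 ⊢
  filter_upwards [h3, (W.memLp_spectrum u).coeFn_toLp] with ξ h4 h5
  rw [h4, spectrum] at h5
  simpa [(W.pos ξ).ne'] using h5.symm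

/-- The space of the square-integrable `u` such that `x ↦ ⟪kernelVec x, u⟫` is real. -/
def space : Submodule ℝ (Lp ℂ 2 (volume : Measure (Rd d))) :=
  ⨅ x, (Complex.imCLM ∘L (innerSL ℂ (W.kernelVec x)).restrictScalars ℝ).ker

theorem mem_space {u : Lp ℂ 2 (volume : Measure (Rd d))} :
    u ∈ W.space ↔ ∀ x, (inner ℂ (W.kernelVec x) u).im = 0 := by
  simp [space]

theorem isClosed_space : IsClosed (W.space : Set (Lp ℂ 2 (volume : Measure (Rd d)))) := by
  rw [space, Submodule.coe_iInf]
  exact isClosed_iInter fun x ↦ ContinuousLinearMap.isClosed_ker _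

instance : CompleteSpace W.space := W.isClosed_space.completeSpace_coe

theorem kernelVec_mem_space (y : Rd d) : W.kernelVec y ∈ W.space :=
  W.mem_space.2 fun x ↦ by rw [W.inner_kernelVec_kernelVec, Complex.ofReal_im]

theorem re_inner (u v : Lp ℂ 2 (volume : Measure (Rd d))) :
    inner ℝ u v = (inner ℂ u v).re := by
  rw [L2.inner_def, L2.inner_def]
  exact integral_re (L2.integrable_inner u v)

theorem inner_kernelVec_of_mem {u : Lp ℂ 2 (volume : Measure (Rd d))} (hu : u ∈ W.space)
    (x : Rd d) : inner ℂ (W.kernelVec x) u = ((inner ℝ (W.kernelVec x) u : ℝ) : ℂ) := by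
  apply Complex.ext
  · rw [re_inner, Complex.ofReal_re]
  · rw [W.mem_space.1 hu, Complex.ofReal_im]

theorem eq_zero_of_mem_of_inner_eq_zero {u : Lp ℂ 2 (volume : Measure (Rd d))} (hu : u ∈ W.space)
    (h : ∀ x, inner ℝ (W.kernelVec x) u = 0) : u = 0 :=
  W.eq_zero_of_inner_kernelVec_eq_zero fun x ↦ by
    rw [W.inner_kernelVec_of_mem hu, h, Complex.ofReal_zero]

instance : RKHS ℝ W.space (Rd d) ℝ where
  coeCLM := .pi fun x ↦ innerSL ℝ (W.kernelVec x) ∘L W.space.subtypeL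
  coeCLM_injective := by
    refine (injective_iff_map_eq_zero _).2 fun u hu ↦ Subtype.ext ?_
    exact W.eq_zero_of_mem_of_inner_eq_zero u.2 fun x ↦ congrFun hu x

theorem apply_eq (u : W.space) (x : Rd d) : u x = inner ℝ (W.kernelVec x) (u : Lp ℂ 2 volume) := rfl

theorem ofReal_apply (u : W.space) (x : Rd d) :
    ((u x : ℝ) : ℂ) = inner ℂ (W.kernelVec x) (u : Lp ℂ 2 volume) :=
  (W.inner_kernelVec_of_mem u.2 x).symm

theorem isReproducingKernel : IsReproducingKernel W.space fun x y ↦ G (x - y) := fun y ↦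
  ⟨⟨W.kernelVec y, W.kernelVec_mem_space y⟩, fun x ↦ by
    rw [apply_eq, re_inner, W.inner_kernelVec_kernelVec, Complex.ofReal_re], fun _ ↦ rfl⟩

theorem continuous_apply (u : W.space) : Continuous u := by
  have : (u : Rd d → ℝ) = fun x ↦ (inner ℂ (W.kernelVec x) (u : Lp ℂ 2 volume)).re :=
    funext fun x ↦ re_inner _ _
  rw [this]
  exact Complex.continuous_re.comp (W.continuous_inner_kernelVec _)

/-- The complex inner product is real on the model space. -/
theorem inner_coe (u v : W.space) :
    inner ℂ (u : Lp ℂ 2 (volume : Measure (Rd d))) v = ((inner ℝ u v : ℝ) : ℂ) := by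
  -- Each `⟪k_x, i v⟫` is purely imaginary, so the projection of `i v` is orthogonal to every `k_x`
  -- and vanishes. Pairing with `u` then gives `Im ⟪u, v⟫ = 0`.
  have h : W.space.orthogonalProjectionOnto (Complex.I • (v : Lp ℂ 2 volume)) = 0 := by
    refine Subtype.ext (W.eq_zero_of_mem_of_inner_eq_zero (Subtype.mem _) fun x ↦ ?_)
    have h1 := W.space.inner_orthogonalProjectionOnto_eq_of_mem_left
      ⟨_, W.kernelVec_mem_space x⟩ (Complex.I • (v : Lp ℂ 2 volume))
    refine h1.trans ?_
    rw [re_inner, inner_smul_right, ← W.ofReal_apply]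
    simp
  have h2 := W.space.inner_orthogonalProjectionOnto_eq_of_mem_left u
    (Complex.I • (v : Lp ℂ 2 volume))
  rw [h, inner_zero_right, re_inner, inner_smul_right] at h2
  apply Complex.ext
  · rw [Complex.ofReal_re, Submodule.coe_inner, re_inner]
  · simpa using h2.symm

/-- Distinct characters are linearly independent (Dedekind). A relation among the `k_x` holds almost
everywhere; dividing by `W > 0` and using continuity makes it a relation among characters. -/
theorem linearIndependent_kernelVec : LinearIndependent ℂ W.kernelVec := by
  have hχ : LinearIndependent ℂ fun (x : Rd d) (ξ : Rd d) ↦ (𝐞 (-inner ℝ ξ x) : ℂ) := by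
    let χ (x : Rd d) : Multiplicative (Rd d) →* ℂ :=
      { toFun := fun ξ ↦ (𝐞 (-inner ℝ ξ.toAdd x) : ℂ)
        map_one' := by simp
        map_mul' := fun ξ η ↦ by
          rw [toAdd_mul, inner_add_left, neg_add, AddChar.map_add_eq_mul, Circle.coe_mul] }
    have hinj : Function.Injective χ := fun x y hxy ↦ by
      by_contra hne
      have hz : ‖x - y‖ ≠ 0 := norm_ne_zero_iff.2 (sub_ne_zero.2 hne)
      -- Chosen so that `⟨ξ, x - y⟩ = 1/2`, where the characters of `x` and `y` differ by the factor
      -- `-1`.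
      let ξ : Rd d := (2 * ‖x - y‖ ^ 2)⁻¹ • (x - y)
      have h1 : 𝐞 (-inner ℝ ξ x) = 𝐞 (-inner ℝ ξ y) :=
        Subtype.ext (DFunLike.congr_fun hxy (Multiplicative.ofAdd ξ))
      have h2 : -inner ℝ ξ y = -inner ℝ ξ x + 1 / 2 := by
        have h3 : inner ℝ ξ (x - y) = 1 / 2 := by
          rw [inner_smul_left, real_inner_self_eq_norm_sq, conj_trivial]
          field_simp
        rw [inner_sub_right] at h3
        linarith
      rw [h2, AddChar.map_add_eq_mul, left_eq_mul] at h1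
      have h4 := congrArg (Subtype.val : Circle → ℂ) h1
      rw [fourierChar_apply, show ((2 * π * (1 / 2) : ℝ) : ℂ) = π by push_cast; ring,
        Complex.exp_pi_mul_I] at h4
      norm_num at h4
    exact (linearIndependent_monoidHom (Multiplicative (Rd d)) ℂ).comp χ hinj
  rw [linearIndependent_iff'] at hχ ⊢
  intro s c hc
  refine hχ s c ?_
  have hcont : Continuous (∑ x ∈ s, c x • fun ξ : Rd d ↦ (𝐞 (-inner ℝ ξ x) : ℂ)) := by
    rw [Finset.sum_fn]
    refine continuous_finsetSum s fun x _ ↦ .const_smul (c := c x) ?_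
    exact continuous_subtype_val.comp (continuous_fourierChar.comp (by fun_prop))
  refine (hcont.ae_eq_iff_eq volume continuous_zero).1 ?_
  have h1 : (∑ x ∈ s, c x • W.kernelVec x : Lp ℂ 2 (volume : Measure (Rd d))) =ᵐ[volume]
      ∑ x ∈ s, c x • fun ξ ↦ (𝐞 (-inner ℝ ξ x) : ℂ) * (W.toFun ξ : ℂ) := by
    refine (Lp.coeFn_finsetSum _ _).trans (eventuallyEq_sum fun x _ ↦ ?_)
    exact (Lp.coeFn_smul _ _).trans ((W.coeFn_kernelVec x).const_smul _)
  rw [hc] at h1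
  filter_upwards [h1, Lp.coeFn_zero ℂ 2 volume] with ξ h2 h3
  rw [h3] at h2
  have hW : (W.toFun ξ : ℂ) ≠ 0 := Complex.ofReal_ne_zero.2 (W.pos ξ).ne'
  refine mul_right_cancel₀ hW ?_
  simpa [Finset.sum_mul, mul_assoc] using h2.symm

theorem isPositiveDefinite (W : SpectralFactor G) (hG : Continuous G)
    (hG' : ∀ x, G (-x) = G x) :
    IsPositiveDefinite G := by
  refine ⟨hG, hG', fun N x hx c hc ↦ ?_⟩
  let u : Lp ℂ 2 (volume : Measure (Rd d)) := ∑ j, (c j : ℂ) • W.kernelVec (x j)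
  have hu : u ≠ 0 := fun h ↦ hc <| funext fun j ↦ by
    simpa using linearIndependent_iff'.1 (W.linearIndependent_kernelVec.comp x hx) Finset.univ
      (fun j ↦ (c j : ℂ)) h j (Finset.mem_univ j)
  have h1 : inner ℂ u u = ((∑ j, ∑ k, c j * c k * G (x j - x k) : ℝ) : ℂ) := by
    simp only [u, sum_inner, inner_sum, inner_smul_left, inner_smul_right,
      W.inner_kernelVec_kernelVec, Complex.ofReal_sum, Complex.ofReal_mul, Complex.conj_ofReal,
      mul_assoc, Finset.mul_sum]
    refine Finset.sum_congr rfl fun j _ ↦ Finset.sum_congr rfl fun k _ ↦ ?_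
    -- The expansion has exchanged the two centers; evenness restores their order.
    rw [← hG', neg_sub]
  have h2 := inner_self_eq_norm_sq_to_K (𝕜 := ℂ) u
  rw [h1] at h2
  have h3 : ∑ j, ∑ k, c j * c k * G (x j - x k) = ‖u‖ ^ 2 := by
    apply Complex.ofReal_injective
    rw [h2]
    simp
  rw [h3]
  positivity

end SpectralFactor

/-! ### Uniqueness of the reproducing-kernel Hilbert space -/

section Uniqueness

variable {X : Type*} {K : X → X → ℝ} {H H₁ H₂ : Type*}
  [NormedAddCommGroup H] [InnerProductSpace ℝ H] [RKHS ℝ H X ℝ]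
  [NormedAddCommGroup H₁] [InnerProductSpace ℝ H₁] [RKHS ℝ H₁ X ℝ]
  [NormedAddCommGroup H₂] [InnerProductSpace ℝ H₂] [RKHS ℝ H₂ X ℝ]

/-- A vector orthogonal to all `k y` vanishes as a function. -/
theorem IsReproducingKernel.denseRange_linearCombination [CompleteSpace H] {k : X → H}
    (hk : ∀ y, ∀ f : H, f y = inner ℝ (k y) f) : DenseRange (Finsupp.linearCombination ℝ k) := by
  change Dense (Set.range _)
  rw [← LinearMap.coe_range, Submodule.dense_iff_topologicalClosure_eq_top,
    Submodule.topologicalClosure_eq_top_iff, Submodule.eq_bot_iff]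
  intro f hf
  refine RKHS.ext fun y ↦ ?_
  rw [hk, RKHS.coe_zero, Pi.zero_apply]
  exact hf _ ⟨Finsupp.single y 1, by simp⟩

/-- Two real Hilbert spaces of functions with the same reproducing kernel are isometric, and the
isometry is the identity on functions. -/
theorem IsReproducingKernel.exists_linearIsometryEquiv [CompleteSpace H₁] [CompleteSpace H₂]
    (h₁ : IsReproducingKernel H₁ K) (h₂ : IsReproducingKernel H₂ K) :
    ∃ e : H₁ ≃ₗᵢ[ℝ] H₂, ∀ f x, e f x = f x := by
  choose k₁ hk₁ hf₁ using h₁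
  choose k₂ hk₂ hf₂ using h₂
  have hin₁ (x y : X) : inner ℝ (k₁ x) (k₁ y) = K x y := by rw [← hf₁, hk₁]
  have hin₂ (x y : X) : inner ℝ (k₂ x) (k₂ y) = K x y := by rw [← hf₂, hk₂]
  -- The norm of a combination of kernel functions depends only on `K`, so matching kernel functions
  -- is isometric on dense subspaces.
  have hnorm (a : X →₀ ℝ) : ‖Finsupp.linearCombination ℝ k₂ (LinearEquiv.refl ℝ _ a)‖ =
      ‖Finsupp.linearCombination ℝ k₁ a‖ := by
    rw [← sq_eq_sq₀ (norm_nonneg _) (norm_nonneg _), ← real_inner_self_eq_norm_sq,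
      ← real_inner_self_eq_norm_sq]
    simp only [LinearEquiv.refl_apply, Finsupp.linearCombination_apply, Finsupp.sum, sum_inner,
      inner_sum, inner_smul_left, inner_smul_right, hin₁, hin₂]
  let e := (LinearEquiv.refl ℝ (X →₀ ℝ)).extendOfIsometry (Finsupp.linearCombination ℝ k₁)
    (Finsupp.linearCombination ℝ k₂) (denseRange_linearCombination hf₁)
    (denseRange_linearCombination hf₂) hnorm
  have he (x : X) : e (k₁ x) = k₂ x := by
    have := LinearEquiv.extendOfIsometry_eq (LinearEquiv.refl ℝ (X →₀ ℝ))
      (Finsupp.linearCombination ℝ k₁) (Finsupp.linearCombination ℝ k₂)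
      (denseRange_linearCombination hf₁) (denseRange_linearCombination hf₂) hnorm
      (Finsupp.single x 1)
    simpa using this
  exact ⟨e, fun f x ↦ by rw [hf₂, ← he, e.inner_map_map, ← hf₁]⟩

end Uniqueness

/-! ### The native space is the generalized Sobolev space -/

theorem norm_multiplier_le (P : Fin n → DiffOp d) (j : Fin n) (ξ : Rd d) :
    ‖(P j).multiplier ξ‖ ≤ ‖symbolVec P ((2 * π) • ξ)‖ :=
  PiLp.norm_apply_le (symbolVec P ((2 * π) • ξ)) j

theorem norm_symbolVec_le_sum (P : Fin n → DiffOp d) (ξ : Rd d) :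
    ‖symbolVec P ((2 * π) • ξ)‖ ≤ ∑ j, ‖(P j).multiplier ξ‖ := by
  have h : symbolVec P ((2 * π) • ξ) =
      ∑ j, EuclideanSpace.single j ((P j).multiplier ξ) := by
    ext i
    simp [symbolVec, DiffOp.multiplier, Finset.sum_apply]
  rw [h]
  exact (norm_sum_le _ _).trans_eq (by simp)

theorem fourier_weakImage_ae_eq (P : Fin n → DiffOp d) (j : Fin n) (f : genSobolev P) :
    (𝓕 (weakImage P j f) : Lp ℂ 2 (volume : Measure (Rd d))) =ᵐ[volume] fun ξ ↦
      (P j).multiplier ξ * (𝓕 (Complex.ofRealCLM.compLp (f : Lp ℝ 2 (volume : Measure (Rd d)))) :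
        Lp ℂ 2 (volume : Measure (Rd d))) ξ :=
  ((P j).toTemperedDistribution_eq_op_iff _ _).1 (f.2 j).choose_spec

namespace SpectralFactor

variable {G : Rd d → ℝ} (W : SpectralFactor G)

theorem memLp_apply (u : W.space) : MemLp u 2 := by
  have h := ((Lp.memLp _).ae_eq (W.fourierInv_spectrum_ae_eq u)).re
  refine h.ae_eq (.of_forall fun x ↦ ?_)
  simp only [← W.ofReal_apply]
  simp

variable {W}

theorem fourier_compLp_ofReal {u : W.space} {f : Lp ℝ 2 (volume : Measure (Rd d))}
    (h : f =ᵐ[volume] u) :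
    (𝓕 (Complex.ofRealCLM.compLp f) : Lp ℂ 2 (volume : Measure (Rd d))) =ᵐ[volume]
      W.spectrum u := by
  have h1 : Complex.ofRealCLM.compLp f =
      (𝓕⁻ (W.memLp_spectrum u).toLp : Lp ℂ 2 (volume : Measure (Rd d))) := by
    refine Lp.ext ?_
    filter_upwards [h, Complex.ofRealCLM.coeFn_compLp f, W.fourierInv_spectrum_ae_eq u]
      with x h1 h2 h3
    rw [h2, h3, h1, ← W.ofReal_apply]
    rfl
  rw [h1, FourierTransform.fourier_fourierInv_eq]
  exact (W.memLp_spectrum u).coeFn_toLp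

variable {P : Fin n → DiffOp d}

/-- The transform of `P_j f` must be `p̂_j(2πξ) W u`, and `|p̂_j(2πξ)| W ≤ 1` keeps it in `L²`. -/
theorem mem_genSobolev (hW : ∀ ξ, W.toFun ξ = ‖symbolVec P ((2 * π) • ξ)‖⁻¹)
    {u : W.space} {f : Lp ℝ 2 (volume : Measure (Rd d))}
    (h : f =ᵐ[volume] u) : f ∈ genSobolev P := by
  intro j
  have hm : MemLp (fun ξ ↦ (P j).multiplier ξ * W.spectrum u ξ) 2 := by
    refine (Lp.memLp (u : Lp ℂ 2 (volume : Measure (Rd d)))).of_le_mul (c := 1)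
      ((P j).continuous_multiplier.aestronglyMeasurable.mul
        (W.integrable_spectrum u).aestronglyMeasurable) (.of_forall fun ξ ↦ ?_)
    rw [spectrum, norm_mul, norm_mul, Complex.norm_real, Real.norm_of_nonneg (W.pos ξ).le,
      ← mul_assoc]
    gcongr
    have h1 := W.pos ξ
    rw [hW] at h1 ⊢
    rw [mul_inv_le_iff₀ (inv_pos.1 h1), one_mul]
    exact norm_multiplier_le P j ξ
  refine ⟨𝓕⁻ hm.toLp, ((P j).toTemperedDistribution_eq_op_iff _ _).2 ?_⟩
  rw [FourierTransform.fourier_fourierInv_eq]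
  filter_upwards [hm.coeFn_toLp, fourier_compLp_ofReal h] with ξ h1 h2
  rw [h1, h2]

theorem exists_ae_eq_of_mem_genSobolev (hW : ∀ ξ, W.toFun ξ = ‖symbolVec P ((2 * π) • ξ)‖⁻¹)
    {f : Lp ℝ 2 (volume : Measure (Rd d))}
    (hf : f ∈ genSobolev P) : ∃ u : W.space, f =ᵐ[volume] u := by
  let F : Lp ℂ 2 (volume : Measure (Rd d)) := 𝓕 (Complex.ofRealCLM.compLp f)
  have hne (ξ : Rd d) : W.toFun ξ ≠ 0 := (W.pos ξ).ne'
  -- The representing vector `W⁻¹ F` is dominated by `∑ |p̂_j(2πξ) F|`, a sum of transforms of the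
  -- `L²` functions `P_j f`.
  have hm : MemLp (fun ξ ↦ ((W.toFun ξ)⁻¹ : ℂ) * F ξ) 2 := by
    have h1 : MemLp (fun ξ ↦ ∑ j, ‖(𝓕 (weakImage P j ⟨f, hf⟩) :
        Lp ℂ 2 (volume : Measure (Rd d))) ξ‖) 2 :=
      memLp_finsetSum _ fun j _ ↦ (Lp.memLp _).norm
    refine h1.of_le_mul (c := 1) ?_ ?_
    · have h2 : Continuous fun ξ ↦ ((W.toFun ξ)⁻¹ : ℂ) :=
        (Complex.continuous_ofReal.comp W.continuous).inv₀
          fun ξ ↦ Complex.ofReal_ne_zero.2 (hne ξ)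
      exact h2.aestronglyMeasurable.mul (Lp.aestronglyMeasurable F)
    · filter_upwards [ae_all_iff.2 fun j ↦ fourier_weakImage_ae_eq P j ⟨f, hf⟩] with ξ h2
      simp_rw [h2, norm_mul, ← Finset.sum_mul, one_mul]
      rw [norm_mul, norm_norm]
      gcongr
      rw [norm_inv, Complex.norm_real, Real.norm_of_nonneg (W.pos ξ).le, hW, inv_inv,
        Real.norm_of_nonneg (by positivity)]
      exact norm_symbolVec_le_sum P ξ
  have hs : (W.memLp_spectrum hm.toLp).toLp = F := by
    refine Lp.ext ?_
    filter_upwards [hm.coeFn_toLp, (W.memLp_spectrum hm.toLp).coeFn_toLp] with ξ h1 h2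
    rw [h2, spectrum, h1, mul_inv_cancel_left₀ (Complex.ofReal_ne_zero.2 (hne ξ))]
  have h1 := W.fourierInv_spectrum_ae_eq hm.toLp
  rw [hs, FourierTransform.fourierInv_fourier_eq] at h1
  -- The represented function equals the real `f` only almost everywhere; continuity makes it real
  -- at every point.
  have h2 : (fun x ↦ (inner ℂ (W.kernelVec x) hm.toLp).im) = fun _ ↦ 0 := by
    refine ((Complex.continuous_im.comp (W.continuous_inner_kernelVec _)).ae_eq_iff_eq volume
      continuous_const).1 ?_
    filter_upwards [h1, Complex.ofRealCLM.coeFn_compLp f] with x h3 h4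
    rw [Function.comp_apply, ← h3, h4]
    simp
  refine ⟨⟨hm.toLp, W.mem_space.2 (congrFun h2)⟩, ?_⟩
  filter_upwards [h1, Complex.ofRealCLM.coeFn_compLp f] with x h3 h4
  apply Complex.ofReal_injective
  rw [W.ofReal_apply, ← h3, h4]
  rfl

theorem sobolevInner_eq (hW : ∀ ξ, W.toFun ξ = ‖symbolVec P ((2 * π) • ξ)‖⁻¹)
    {u v : W.space} {f g : genSobolev P}
    (hu : ((f : Lp ℝ 2 (volume : Measure (Rd d))) : Rd d → ℝ) =ᵐ[volume] u)
    (hv : ((g : Lp ℝ 2 (volume : Measure (Rd d))) : Rd d → ℝ) =ᵐ[volume] v) :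
    sobolevInner P f g = ((inner ℝ u v : ℝ) : ℂ) := by
  have h1 (j : Fin n) : ∫ x, weakImage P j f x * starRingEnd ℂ (weakImage P j g x) =
      inner ℂ (𝓕 (weakImage P j g) : Lp ℂ 2 (volume : Measure (Rd d)))
        (𝓕 (weakImage P j f) : Lp ℂ 2 (volume : Measure (Rd d))) := by
    rw [Lp.inner_fourier_eq, L2.inner_def]
    simp only [RCLike.inner_apply]
  -- The Sobolev form conjugates its second argument and the complex inner product its first; `u`
  -- and `v` are exchanged to match.
  rw [real_inner_comm, ← W.inner_coe, sobolevInner]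
  simp_rw [h1, L2.inner_def]
  rw [← integral_finsetSum _ fun j _ ↦ L2.integrable_inner _ _]
  refine integral_congr_ae ?_
  filter_upwards [ae_all_iff.2 fun j ↦ fourier_weakImage_ae_eq P j f,
    ae_all_iff.2 fun j ↦ fourier_weakImage_ae_eq P j g, fourier_compLp_ofReal hu,
    fourier_compLp_ofReal hv] with ξ h2 h3 h4 h5
  have h6 := sum_conj_mul_multiplier P ξ
  have h7 : (‖symbolVec P ((2 * π) • ξ)‖ : ℂ) * W.toFun ξ = 1 := by
    have h8 := W.pos ξ
    rw [hW] at h8 ⊢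
    rw [← Complex.ofReal_mul, mul_inv_cancel₀ (inv_pos.1 h8).ne', Complex.ofReal_one]
  calc _ = (∑ j, starRingEnd ℂ ((P j).multiplier ξ) * (P j).multiplier ξ) *
        ((W.toFun ξ : ℂ) ^ 2 * (u.1 ξ * starRingEnd ℂ (v.1 ξ))) := by
        rw [Finset.sum_mul]
        refine Finset.sum_congr rfl fun j _ ↦ ?_
        rw [h2, h3, h4, h5, RCLike.inner_apply, spectrum, spectrum, map_mul, map_mul,
          Complex.conj_ofReal]
        ring
    _ = ((‖symbolVec P ((2 * π) • ξ)‖ : ℂ) * W.toFun ξ) ^ 2 *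
        (u.1 ξ * starRingEnd ℂ (v.1 ξ)) := by
        rw [h6]
        push_cast
        ring
    _ = _ := by rw [h7, one_pow, one_mul, RCLike.inner_apply]

/-- Passing to classes modulo equality almost everywhere is a linear bijection of the model space
onto the generalized Sobolev space. -/
theorem exists_linearEquiv_genSobolev (hW : ∀ ξ, W.toFun ξ = ‖symbolVec P ((2 * π) • ξ)‖⁻¹) :
    ∃ e : W.space ≃ₗ[ℝ] genSobolev P, ∀ u : W.space,
      ((e u : Lp ℝ 2 (volume : Measure (Rd d))) : Rd d → ℝ) =ᵐ[volume] u := by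
  let T : W.space →ₗ[ℝ] genSobolev P :=
    { toFun := fun u ↦ ⟨(W.memLp_apply u).toLp, mem_genSobolev hW (W.memLp_apply u).coeFn_toLp⟩
      map_add' := fun u v ↦ Subtype.ext (by
        simp only [RKHS.coe_add]
        exact (W.memLp_apply u).toLp_add (W.memLp_apply v))
      map_smul' := fun c u ↦ Subtype.ext (by
        simp only [RKHS.coe_smul]
        exact (W.memLp_apply u).toLp_const_smul c) }
  have hT (u : W.space) : ((T u : Lp ℝ 2 (volume : Measure (Rd d))) : Rd d → ℝ) =ᵐ[volume] u :=
    (W.memLp_apply u).coeFn_toLp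
  refine ⟨.ofBijective T ⟨fun u v huv ↦ ?_, fun f ↦ ?_⟩, hT⟩
  · have h := hT u
    rw [huv] at h
    exact DFunLike.coe_injective (((W.continuous_apply u).ae_eq_iff_eq volume
      (W.continuous_apply v)).1 (h.symm.trans (hT v)))
  · obtain ⟨u, hu⟩ := exists_ae_eq_of_mem_genSobolev hW f.2
    exact ⟨u, Subtype.ext (Lp.ext ((hT u).trans hu.symm))⟩

end SpectralFactor

/-- A Green function of `L` has the spectral factor `ξ ↦ ‖p̂(2πξ)‖⁻¹`. -/
theorem exists_spectralFactor {P : Fin n → DiffOp d} (hP : ∀ x, symbolVec P x ≠ 0)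
    (hP_int : Integrable (fun x ↦ ‖symbolVec P x‖ ^ (-2 : ℤ))) {G : Rd d → ℝ}
    (hG_cont : Continuous G) {hG_int : Integrable G}
    (hG : IsGreenFunction (adjointCompSelf P) (integrableDistr hG_int)) :
    ∃ W : SpectralFactor G, ∀ ξ, W.toFun ξ = ‖symbolVec P ((2 * π) • ξ)‖⁻¹ := by
  have hpos (ξ : Rd d) : 0 < ‖symbolVec P ((2 * π) • ξ)‖ := norm_pos_iff.2 (hP _)
  have hcont : Continuous fun ξ ↦ ‖symbolVec P ((2 * π) • ξ)‖ :=
    ((PiLp.continuous_toLp 2 _).comp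
      (continuous_pi fun j ↦ (P j).continuous_multiplier)).norm
  have hcont' : Continuous fun ξ ↦ ‖symbolVec P ((2 * π) • ξ)‖⁻¹ :=
    hcont.inv₀ fun ξ ↦ (hpos ξ).ne'
  have hsq : Integrable fun ξ ↦ ‖symbolVec P ((2 * π) • ξ)‖⁻¹ ^ 2 := by
    refine (hP_int.comp_smul (R := 2 * π) (by positivity)).congr (.of_forall fun ξ ↦ ?_)
    simp only [zpow_neg, inv_pow]
    rfl
  have hfour : 𝓕 (fun x ↦ (G x : ℂ)) =
      fun ξ ↦ ((‖symbolVec P ((2 * π) • ξ)‖⁻¹ : ℝ) : ℂ) ^ 2 := by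
    ext ξ
    rw [eq_inv_of_mul_eq_one_right (hG.mul_fourier_eq_one ξ)]
    push_cast
    rw [inv_pow]
  have hGc : Integrable fun x ↦ (G x : ℂ) := hG_int.ofReal
  refine ⟨{ toFun := fun ξ ↦ ‖symbolVec P ((2 * π) • ξ)‖⁻¹, continuous := hcont'
            pos := fun ξ ↦ inv_pos.2 (hpos ξ), memLp := ?_, exists_le := ?_
            fourierInv_sq := fun x ↦ ?_ }, fun _ ↦ rfl⟩
  · exact ((memLp_two_iff_integrable_sq hcont'.aestronglyMeasurable).2 hsq).ofReal
  -- `W²` is the transform of `G`, hence at most the `L¹` norm of `G`.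
  · refine ⟨√(∫ x, ‖(G x : ℂ)‖), fun ξ ↦ Real.le_sqrt_of_sq_le ?_⟩
    have h := VectorFourier.norm_fourierIntegral_le_integral_norm 𝐞 volume (innerₗ (Rd d))
      (fun x ↦ (G x : ℂ)) ξ
    change ‖𝓕 (fun x ↦ (G x : ℂ)) ξ‖ ≤ _ at h
    rwa [hfour, norm_pow, Complex.norm_real, norm_inv, norm_norm] at h
  · rw [← hfour]
    -- Inversion holds at every point since `G` is continuous and integrable with integrable
    -- transform.
    refine congrFun (Continuous.fourierInv_fourier_eq (by fun_prop) hGc ?_) x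
    rw [hfour]
    exact_mod_cast hsq.ofReal (𝕜 := ℂ)

end GenSobolev

end

theorem theoremt {d n : ℕ} (P : Fin n → GenSobolev.DiffOp d)
    (hP : ∀ x, GenSobolev.symbolVec P x ≠ 0)
    (hP_int : Integrable (fun x ↦ ‖GenSobolev.symbolVec P x‖ ^ (-2 : ℤ)))
    (G : GenSobolev.Rd d → ℝ) (hG_cont : Continuous G) (hG_int : Integrable G)
    (hG_even : ∀ x, G (-x) = G x)
    (hG : GenSobolev.IsGreenFunction (GenSobolev.adjointCompSelf P)
      (GenSobolev.integrableDistr hG_int)) :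
    GenSobolev.IsPositiveDefinite G ∧
    -- the reproducing-kernel Hilbert space of `G` exists
    (∃ (N : Type) (_ : NormedAddCommGroup N) (_ : InnerProductSpace ℝ N) (_ : CompleteSpace N)
      (_ : RKHS ℝ N (GenSobolev.Rd d) ℝ),
      GenSobolev.IsReproducingKernel N (fun x y ↦ G (x - y))) ∧
    -- and it is the generalized Sobolev space, with the same inner product
    ∀ (N : Type*) [NormedAddCommGroup N] [InnerProductSpace ℝ N] [CompleteSpace N]
      [RKHS ℝ N (GenSobolev.Rd d) ℝ],
      GenSobolev.IsReproducingKernel N (fun x y ↦ G (x - y)) →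
        (∀ f : N, Continuous f) ∧
        ∃ e : N ≃ₗ[ℝ] GenSobolev.genSobolev P,
          (∀ f : N, ((e f : Lp ℝ 2 (volume : Measure (GenSobolev.Rd d))) : GenSobolev.Rd d → ℝ)
            =ᵐ[volume] f) ∧
          ∀ f g : N, ((inner ℝ f g : ℝ) : ℂ) = GenSobolev.sobolevInner P (e f) (e g) := by
  obtain ⟨W, hW⟩ := GenSobolev.exists_spectralFactor hP hP_int hG_cont hG
  refine ⟨W.isPositiveDefinite hG_cont hG_even,
    ⟨W.space, inferInstance, inferInstance, inferInstance, inferInstance, W.isReproducingKernel⟩, ?_⟩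
  intro N _ _ _ _ hN
  obtain ⟨e, he⟩ := hN.exists_linearIsometryEquiv W.isReproducingKernel
  obtain ⟨T, hT⟩ := GenSobolev.SpectralFactor.exists_linearEquiv_genSobolev hW
  have he' (f : N) : (e f : GenSobolev.Rd d → ℝ) = f := funext (he f)
  refine ⟨fun f ↦ he' f ▸ W.continuous_apply (e f), e.toLinearEquiv.trans T, fun f ↦ ?_,
    fun f g ↦ ?_⟩
  · exact (hT (e f)).trans (.of_eq (he' f))
  · rw [← e.inner_map_map]
    exact (GenSobolev.SpectralFactor.sobolevInner_eq hW (hT (e f)) (hT (e g))).symm
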